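/- Let $d\ge 1$ and let $P\subset\mathbb R^d$ be a $d$-dimensional convex polytope with exactly $m$ vertices $v_1,\dots,v_m$ and boundary $\partial P$. Let $X$ be a finite simplicial complex of dimension $d$ and let $T$ be a triangulation of $X$, i.e. a finite simplicial complex whose polyhedron $|T|$ is homeomorphic to $|X|$. Let $L:\mathrm{Vert}(T)\to\{1,\dots,m\}$ be a labelling, and let $f_{L,P}:|T|\to P$ be the map that is affine on every simplex of $T$ and sends each vertex $u$ to $v_{L(u)}$. Let $\mathrm{Bd}\,T$ be the subcomplex of $T$ consisting of all $(d-1)$-simplices of $T$ that are contained in an odd number of $d$-simplices of $T$, together with all faces of these $(d-1)$-simplices. Suppose that $f_{L,P}(|\mathrm{Bd}\,T|)\subseteq\partial P$. Let $\mathrm{dg2}(L,\mathrm{Bd}\,T)\in\mathbb Z/2$ be the mod 2 degree of $f_{L,P}|_{|\mathrm{Bd}\,T|}:|\mathrm{Bd}\,T|\to\partial P\cong S^{d-1}$, i.e. the parity of the number of points of $|\mathrm{Bd}\,T|$ mapped to $y$, where $y\in\partial P$ is any point not in the image of a simplex of $\mathrm{Bd}\,T$ of dimension less than $d-1$ (this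 parity does not depend on $y$). If $\mathrm{dg2}(L,\mathrm{Bd}\,T)$ is odd, then $T$ contains at least $m-d$ fully labelled $d$-simplices, i.e. $d$-simplices whose $d+1$ vertices have pairwise distinct labels. -/

import Mathlib

open Set

noncomputable section

namespace LabelledComplex

variable {V : Type*}

/-- The complex `K` has dimension exactly `d` (a `k`-simplex is a face with `k + 1` vertices). -/
def HasDim (K : PreAbstractSimplicialComplex V) (d : ℕ) : Prop :=
  (∃ s ∈ K.faces, s.card = d + 1) ∧ ∀ s ∈ K.faces, s.card ≤ d + 1

/-- The polyhedron `|K|` of a finite simplicial complex, in barycentric coordinates: a point is a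
family of nonnegative weights on the vertices, of total weight one, supported on a face. -/
def space [Fintype V] (K : PreAbstractSimplicialComplex V) : Set (V → ℝ) :=
  {w | w ∈ stdSimplex ℝ V ∧ ∃ s ∈ K.faces, ∀ u, w u ≠ 0 → u ∈ s}

/-- `T` is a triangulation of (the polyhedron of) `X`. -/
def IsTriangulationOf {W : Type*} [Fintype V] [Fintype W]
    (T : PreAbstractSimplicialComplex V) (X : PreAbstractSimplicialComplex W) : Prop :=
  Nonempty (space T ≃ₜ space X)

/-- The subcomplex of all simplices of dimension less than `n`, that is, with at most `n`
vertices. -/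
def skeletonBelow (K : PreAbstractSimplicialComplex V) (n : ℕ) :
    PreAbstractSimplicialComplex V where
  faces := {s | s ∈ K.faces ∧ s.card ≤ n}
  isRelLowerSet_faces := fun _ hs =>
    ⟨(K.isRelLowerSet_faces hs.1).1, fun _ hts ht =>
      ⟨(K.isRelLowerSet_faces hs.1).2 hts ht, (Finset.card_le_card hts).trans hs.2⟩⟩

/-- The mod 2 boundary `Bd K` of a `d`-dimensional complex: the `(d-1)`-simplices of `K` that are
contained in an odd number of `d`-simplices of `K`, together with all the (nonempty) faces of these
`(d-1)`-simplices. -/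
def Bd (K : PreAbstractSimplicialComplex V) (d : ℕ) : PreAbstractSimplicialComplex V where
  faces := {t | t.Nonempty ∧ ∃ s ∈ K.faces, s.card = d ∧
    Odd {r : Finset V | r ∈ K.faces ∧ r.card = d + 1 ∧ s ⊆ r}.ncard ∧ t ⊆ s}
  isRelLowerSet_faces := by
    rintro t ⟨ht, s, hs, hc, ho, hts⟩
    exact ⟨ht, fun t' h' hne => ⟨hne, s, hs, hc, ho, Finset.Subset.trans h' hts⟩⟩

variable {E : Type*} [AddCommGroup E] [Module ℝ E]

/-- The map that is affine on every simplex and sends each vertex `u` to `v (L u)`. -/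
def labelMap [Fintype V] {m : ℕ} (v : Fin m → E) (L : V → Fin m) (w : V → ℝ) : E :=
  ∑ u, w u • v (L u)

/-- `y` is a regular value in `S` of a simplexwise affine map `g : |B| → S`, where `B` is
`n`-dimensional: `y` is not in the image of the simplices of `B` of dimension less than `n`.
Such a point has only finitely many preimages, all interior to `n`-simplices on which `g` is
injective. -/
def IsRegularValue [Fintype V] (B : PreAbstractSimplicialComplex V) (n : ℕ)
    (g : (V → ℝ) → E) (S : Set E) (y : E) : Prop :=
  y ∈ S ∧ y ∉ g '' space (skeletonBelow B n)

open Classical in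
/-- The mod 2 degree of a simplexwise affine map `g : |B| → S`, where `B` is an `n`-dimensional
complex that is a mod 2 boundary and `S` is an `n`-sphere: the parity of the number of preimages of
a regular value. This parity does not depend on the regular value, so that the degree is `1`
exactly when some regular value has an odd number of preimages. -/
def modTwoDegree [Fintype V] (B : PreAbstractSimplicialComplex V) (n : ℕ)
    (g : (V → ℝ) → E) (S : Set E) : ZMod 2 :=
  if ∃ y, IsRegularValue B n g S y ∧ Odd {w | w ∈ space B ∧ g w = y}.ncard then 1 else 0

/-- A convex polytope: the convex hull of finitely many points. -/
def IsConvexPolytope (P : Set E) : Prop :=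
  ∃ s : Set E, s.Finite ∧ P = convexHull ℝ s

/-- The fully labelled `d`-simplices of `K`: those whose `d + 1` vertices have pairwise distinct
labels. -/
def fullyLabelled {m : ℕ} (K : PreAbstractSimplicialComplex V) (d : ℕ) (L : V → Fin m) :
    Set (Finset V) :=
  {s | s ∈ K.faces ∧ s.card = d + 1 ∧ Set.InjOn L (s : Set V)}

end LabelledComplex

end

/-!
Call a simplex rainbow if its vertices have pairwise distinct labels. Two `d`-simplices of `T` are
adjacent if they share a rainbow `(d-1)`-simplex. A component of this adjacency with `k` fully
labelled `d`-simplices carries at most `d + k` labels (`card_labels_le_of_connected`), since moving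
on to an adjacent simplex adds at most one label, and none unless the simplex is fully labelled. So
it suffices to find a component in which all `m` labels occur.

By regularity, the preimages of a regular value `y` correspond to the rainbow `(d-1)`-simplices of
`Bd T` whose images contain `y` (`IsRegularValue.ncard_preimage`). Each of these belongs to exactly
one component, so that some component `C` has an odd number of them (`exists_odd_component`). All
labels occur in `C`. Indeed, if the label `i` does not, then the image of `C` misses the points of
the interior of `P` near `v i`, and this forces the number to be even
(`even_card_boundary_of_disjoint`): choose such a point `p` in general position, and a point `z`
beyond `p` on the ray from `y` through `p`. The joins of `z` with the boundary simplices of `C` that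
contain `p` are those with the boundary simplices that contain `y`. On the other hand, among `d + 2`
points in a `d`-dimensional space, an even number of the sets of `d + 1` points contain `p` in their
convex hull (`even_card_mem_convexHull_compl_singleton`). Applied to `z` and the vertices of each
simplex of `C`, and summed over `C`, this shows that the number of these joins is even.

This requires `y` to be in general position with respect to all simplices of `T` and not only to
those of `Bd T`. To achieve it, `y` is moved within a supporting hyperplane
(`exists_generic_mem_frontier`), which does not change the simplices of `Bd T` that contain it.

The dimension of `T` plays no role: only the `d`-simplices of `T` and their facets occur.
-/

/-! ### Convex combinations and parity -/

namespace LabelledComplex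

open Filter Topology

theorem mem_convexHull_image_iff {ι E : Type*} [Fintype ι] [AddCommGroup E] [Module ℝ E]
    (x : ι → E) (s : Set ι) (p : E) :
    p ∈ convexHull ℝ (x '' s) ↔
      ∃ w : ι → ℝ, (∀ i, 0 ≤ w i) ∧ (∀ i, w i ≠ 0 → i ∈ s) ∧ ∑ i, w i = 1 ∧
        ∑ i, w i • x i = p := by
  classical
  constructor
  · intro hp
    have hconv : Convex ℝ {p : E | ∃ w : ι → ℝ, (∀ i, 0 ≤ w i) ∧ (∀ i, w i ≠ 0 → i ∈ s) ∧
        ∑ i, w i = 1 ∧ ∑ i, w i • x i = p} := by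
      rintro _ ⟨w, hw0, hws, hw1, rfl⟩ _ ⟨w', hw0', hws', hw1', rfl⟩ a b ha hb hab
      refine ⟨fun i => a * w i + b * w' i, fun i => ?_, fun i hi => ?_, ?_, ?_⟩
      · have := hw0 i
        have := hw0' i
        positivity
      · by_contra his
        have h1 : w i = 0 := by_contra fun h => his (hws i h)
        have h2 : w' i = 0 := by_contra fun h => his (hws' i h)
        simp [h1, h2] at hi
      · simp [Finset.sum_add_distrib, ← Finset.mul_sum, hw1, hw1', hab]
      · simp [add_smul, mul_smul, Finset.sum_add_distrib, ← Finset.smul_sum]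
    refine convexHull_min ?_ hconv hp
    rintro _ ⟨i, hi, rfl⟩
    refine ⟨Pi.single i 1, fun j => ?_, fun j hj => ?_, by simp, ?_⟩
    · by_cases h : j = i
      · subst h; simp
      · simp [h]
    · by_cases h : j = i
      · exact h ▸ hi
      · simp [h] at hj
    · rw [Finset.sum_eq_single i] <;> simp +contextual
  · rintro ⟨w, hw0, hws, hw1, rfl⟩
    have hz : ∀ i, i ∉ Finset.univ.filter (· ∈ s) → w i = 0 := fun i hi => by
      by_contra h
      exact hi (by simpa using hws i h)
    rw [← Finset.sum_subset (Finset.subset_univ (Finset.univ.filter (· ∈ s)))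
      (fun i _ hi => by rw [hz i hi, zero_smul])]
    rw [← Finset.sum_subset (Finset.subset_univ (Finset.univ.filter (· ∈ s)))
      (fun i _ hi => hz i hi)] at hw1
    refine (convex_convexHull ℝ _).sum_mem (fun i _ => hw0 i) hw1 fun i hi => ?_
    exact subset_convexHull ℝ _ ⟨i, by simpa using hi, rfl⟩

/-- Moving nonnegative weights in a direction with a negative coordinate, one reaches weights that
are still nonnegative and of which a decreasing one vanishes. -/
theorem exists_nonneg_add_mul_eq_zero {ι : Type*} [Fintype ι] (w μ : ι → ℝ) (hw : ∀ i, 0 ≤ w i)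
    (hμ : ∃ j, μ j < 0) :
    ∃ t : ℝ, 0 ≤ t ∧ (∀ i, 0 ≤ w i + t * μ i) ∧ ∃ j, μ j < 0 ∧ w j + t * μ j = 0 := by
  classical
  obtain ⟨j, hj, hmin⟩ := Finset.exists_min_image (Finset.univ.filter fun j => μ j < 0)
    (fun j => w j / (-μ j)) (by obtain ⟨j, hj⟩ := hμ; exact ⟨j, by simpa using hj⟩)
  have hj : μ j < 0 := by simpa using hj
  refine ⟨w j / (-μ j), div_nonneg (hw j) (by linarith), fun i => ?_, j, hj, ?_⟩
  · by_cases hi : μ i < 0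
    · have h1 := hmin i (by simpa using hi)
      have h2 : w j / (-μ j) * (-μ i) ≤ w i := (le_div_iff₀ (by linarith)).1 h1
      linarith
    · have : 0 ≤ w j / (-μ j) := div_nonneg (hw j) (by linarith)
      have := mul_nonneg this (not_lt.1 hi)
      linarith [hw i]
  · have : μ j ≠ 0 := hj.ne
    field_simp
    ring

theorem exists_neg_of_sum_eq_zero {ι : Type*} [Fintype ι] {μ : ι → ℝ} (h0 : ∑ i, μ i = 0)
    (hne : μ ≠ 0) : ∃ j, μ j < 0 := by
  by_contra! h
  exact hne (funext fun i => (Finset.sum_eq_zero_iff_of_nonneg fun i _ => h i).1 h0 i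
    (Finset.mem_univ i))

/-- Along an affine dependence `μ` of the points `x`, nonnegative weights `w` can be changed,
without changing the point that they represent, until some weight that `μ` decreases vanishes. -/
theorem exists_weights_of_dependence {ι E : Type*} [Fintype ι] [AddCommGroup E] [Module ℝ E]
    (x : ι → E) {w μ : ι → ℝ} (hw : ∀ i, 0 ≤ w i) (hμ0 : ∑ i, μ i = 0)
    (hμx : ∑ i, μ i • x i = 0) (hne : ∃ j, μ j < 0) :
    ∃ w' : ι → ℝ, (∀ i, 0 ≤ w' i) ∧ ∑ i, w' i = ∑ i, w i ∧
      ∑ i, w' i • x i = ∑ i, w i • x i ∧ (∀ i, μ i = 0 → w' i = w i) ∧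
      ∃ j, μ j < 0 ∧ w' j = 0 := by
  obtain ⟨t, -, h0, j, hj, hj0⟩ := exists_nonneg_add_mul_eq_zero w μ hw hne
  refine ⟨fun i => w i + t * μ i, h0, ?_, ?_, fun i hi => by simp [hi], j, hj, hj0⟩
  · simp [Finset.sum_add_distrib, ← Finset.mul_sum, hμ0]
  · simp [add_smul, mul_smul, Finset.sum_add_distrib, ← Finset.smul_sum, hμx]

open Classical in
/-- Among the simplices spanned by all but one of `d + 2` points in a `d`-dimensional space, an even
number contains a given point in general position. -/
theorem even_card_mem_convexHull_compl_singleton {ι E : Type*} [Fintype ι] [AddCommGroup E]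
    [Module ℝ E] [FiniteDimensional ℝ E] (hι : Fintype.card ι = Module.finrank ℝ E + 2)
    (x : ι → E) (p : E) (hp : ∀ i j, i ≠ j → p ∉ convexHull ℝ (x '' {i, j}ᶜ)) :
    Even (Finset.univ.filter fun i => p ∈ convexHull ℝ (x '' {i}ᶜ)).card := by
  -- the weights representing `p` as a convex combination
  set A : Set (ι → ℝ) := {w | (∀ i, 0 ≤ w i) ∧ ∑ i, w i = 1 ∧ ∑ i, w i • x i = p} with hA
  have hmem : ∀ i, p ∈ convexHull ℝ (x '' {i}ᶜ) ↔ ∃ w ∈ A, w i = 0 := by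
    intro i
    rw [mem_convexHull_image_iff]
    constructor
    · rintro ⟨w, h0, hs, h1, hx⟩
      exact ⟨w, ⟨h0, h1, hx⟩, by_contra fun h => hs i h rfl⟩
    · rintro ⟨w, ⟨h0, h1, hx⟩, hi⟩
      exact ⟨w, h0, fun j hj hji => hj (hji ▸ hi), h1, hx⟩
  have hgen : ∀ w ∈ A, ∀ i j, w i = 0 → w j = 0 → i = j := by
    rintro w ⟨h0, h1, hx⟩ i j hi hj
    by_contra hij
    refine hp i j hij ((mem_convexHull_image_iff _ _ _).2 ⟨w, h0, fun k hk hk' => ?_, h1, hx⟩)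
    rcases hk' with rfl | rfl
    · exact hk hi
    · exact hk hj
  -- an affine dependence with a negative coordinate leads from `w ∈ A` to another zero
  have hmove : ∀ w ∈ A, ∀ μ : ι → ℝ, ∑ i, μ i = 0 → ∑ i, μ i • x i = 0 → μ ≠ 0 →
      ∃ j, μ j < 0 ∧ ∃ w' ∈ A, w' j = 0 ∧ ∀ i, μ i = 0 → w' i = w i := by
    rintro w ⟨h0, h1, hx⟩ μ hμ0 hμx hne
    obtain ⟨w', h0', h1', hx', heq, j, hj, hj0⟩ :=
      exists_weights_of_dependence x h0 hμ0 hμx (exists_neg_of_sum_eq_zero hμ0 hne)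
    exact ⟨j, hj, w', ⟨h0', h1'.trans h1, hx'.trans hx⟩, hj0, heq⟩
  have hker : ∀ w ∈ A, ∀ i, w i = 0 → ∀ μ : ι → ℝ, ∑ i, μ i = 0 → ∑ i, μ i • x i = 0 →
      μ i = 0 → μ = 0 := by
    intro w hw i hi μ hμ0 hμx hμi
    by_contra hne
    obtain ⟨j, hj, w', hw', hj0, heq⟩ := hmove w hw μ hμ0 hμx hne
    have := hgen w' hw' i j ((heq i hμi).trans hi) hj0
    subst this
    linarith
  obtain ⟨μ, hμne, hμ0, hμx⟩ : ∃ μ : ι → ℝ, μ ≠ 0 ∧ ∑ i, μ i = 0 ∧ ∑ i, μ i • x i = 0 := by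
    let f : (ι → ℝ) →ₗ[ℝ] ℝ × E :=
      (∑ i, LinearMap.proj i).prod (∑ i, (LinearMap.proj i).smulRight (x i))
    have hf : LinearMap.ker f ≠ ⊥ := LinearMap.ker_ne_bot_of_finrank_lt (by
      simp [hι]; omega)
    obtain ⟨μ, hμ, hne⟩ := (Submodule.ne_bot_iff _).1 hf
    refine ⟨μ, hne, ?_⟩
    have := LinearMap.mem_ker.1 hμ
    simpa [f, Prod.ext_iff, LinearMap.sum_apply] using this
  set Z := Finset.univ.filter fun i => p ∈ convexHull ℝ (x '' {i}ᶜ) with hZ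
  rcases Z.eq_empty_or_nonempty with h | ⟨i, hi⟩
  · simp [h]
  have hZmem : ∀ i, i ∈ Z ↔ ∃ w ∈ A, w i = 0 := fun i => by simp [hZ, hmem]
  obtain ⟨w, hw, hwi⟩ := (hZmem i).1 hi
  have hμi : μ i ≠ 0 := fun h => hμne (hker w hw i hwi μ hμ0 hμx h)
  -- a second index, found by moving along `μ` in the direction that increases the weight of `i`
  obtain ⟨j, hj, hij⟩ : ∃ j ∈ Z, i ≠ j := by
    rcases lt_or_gt_of_ne hμi with h | h
    · obtain ⟨j, hj, w', hw', hj0, -⟩ := hmove w hw (-μ) (by simp [hμ0]) (by simp [hμx])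
        (by simpa using hμne)
      refine ⟨j, (hZmem j).2 ⟨w', hw', hj0⟩, ?_⟩
      rintro rfl
      simp at hj
      linarith
    · obtain ⟨j, hj, w', hw', hj0, -⟩ := hmove w hw μ hμ0 hμx hμne
      refine ⟨j, (hZmem j).2 ⟨w', hw', hj0⟩, ?_⟩
      rintro rfl
      linarith
  suffices h : Z = {i, j} by rw [h, Finset.card_pair hij]; exact even_two
  ext k
  simp only [Finset.mem_insert, Finset.mem_singleton]
  refine ⟨fun hk => ?_, ?_⟩
  swap
  · rintro (rfl | rfl) <;> assumption
  by_contra! hne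
  obtain ⟨hki, hkj⟩ := hne
  obtain ⟨a, ha, haj⟩ := (hZmem j).1 hj
  obtain ⟨b, hb, hbk⟩ := (hZmem k).1 hk
  have hpos : ∀ u ∈ A, ∀ i j, u i = 0 → j ≠ i → 0 < u j := fun u hu i j hui hji =>
    lt_of_le_of_ne (hu.1 j) fun h => hji (hgen u hu j i h.symm hui)
  -- `a` and `b` lie on the same ray from `w`
  have hab : ∀ l, b i * (a l - w l) = a i * (b l - w l) := by
    have := hker w hw i hwi (fun l => b i * (a l - w l) - a i * (b l - w l)) ?_ ?_ (by
      simp [hwi]; ring)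
    · intro l
      have := congrFun this l
      simp at this
      linarith
    · simp [Finset.sum_sub_distrib, ← Finset.mul_sum, hw.2.1, ha.2.1, hb.2.1]
    · simp [sub_smul, mul_smul, Finset.sum_sub_distrib, ← Finset.smul_sum, hw.2.2, ha.2.2,
        hb.2.2]
  have hai := hpos a ha j i haj hij
  have hbi := hpos b hb k i hbk (Ne.symm hki)
  have hwj := hpos w hw i j hwi (Ne.symm hij)
  have hwk := hpos w hw i k hwi hki
  have hbj := hpos b hb k j hbk (Ne.symm hkj)
  have hak := hpos a ha j k haj hkj
  have h1 := hab j
  have h2 := hab k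
  rw [haj] at h1
  rw [hbk] at h2
  nlinarith [mul_pos hai hbj, mul_pos hbi hak, mul_pos hai hwj, mul_pos hbi hwk]

open Classical in
/-- The previous parity statement for the simplex on the vertex set `r` and an additional point
`z`: a point `p` in general position lies in an even number of the simplices formed by `r` and by
the joins of `z` with the facets of `r`. -/
theorem even_card_facets_join {V E : Type*} [AddCommGroup E]
    [Module ℝ E] [FiniteDimensional ℝ E] (g : V → E) (r : Finset V)
    (hr : r.card = Module.finrank ℝ E + 1) (p z : E)
    (hp : ∀ t ⊆ r, t.card ≤ Module.finrank ℝ E → p ∉ convexHull ℝ (g '' (t : Set V)))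
    (hpz : ∀ t ⊆ r, t.card < Module.finrank ℝ E →
      p ∉ convexHull ℝ (insert z (g '' (t : Set V))))
    (hpr : p ∉ convexHull ℝ (g '' (r : Set V))) :
    Even ((r.powersetCard (Module.finrank ℝ E)).filter fun s : Finset V =>
      p ∈ convexHull ℝ (insert z (g '' (s : Set V)))).card := by
  let x : Option r → E := fun o => o.elim z fun u => g u
  have hsome : ∀ u : r, x '' {some u}ᶜ = insert z (g '' (r.erase u : Set V)) := by
    intro u
    ext q
    constructor
    · rintro ⟨_ | u', hu', rfl⟩
      · exact Or.inl rfl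
      · refine Or.inr ⟨u', ?_, rfl⟩
        have : u' ≠ u := by simpa using hu'
        simp [this]
    · rintro (rfl | ⟨u', hu', rfl⟩)
      · exact ⟨none, by simp, rfl⟩
      · have : u' ≠ u ∧ u' ∈ r := by simpa [and_comm] using hu'
        refine ⟨some ⟨u', this.2⟩, ?_, rfl⟩
        simpa [Subtype.ext_iff] using this.1
  have hsub : ∀ u : r, x '' {some u, none}ᶜ ⊆ g '' (r.erase u : Set V) := by
    rintro u _ ⟨_ | u', hu', rfl⟩
    · simp at hu'
    · refine ⟨u', ?_, rfl⟩
      have : u' ≠ u := by simpa using hu'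
      simp [this]
  have hsub' : ∀ u u' : r, x '' {some u, some u'}ᶜ ⊆
      insert z (g '' ((r.erase u).erase u' : Set V)) := by
    rintro u u' _ ⟨_ | u₁, hu', rfl⟩
    · exact Or.inl rfl
    · refine Or.inr ⟨u₁, ?_, rfl⟩
      have : u₁ ≠ u ∧ u₁ ≠ u' := by simpa using hu'
      simp [this]
  have hnone : x '' {none}ᶜ ⊆ g '' (r : Set V) := by
    rintro _ ⟨_ | u', hu', rfl⟩
    · simp at hu'
    · exact ⟨u', u'.2, rfl⟩
  have key := even_card_mem_convexHull_compl_singleton (by simp [hr]) x p (by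
    have h1 : ∀ u : r, p ∉ convexHull ℝ (x '' {some u, none}ᶜ) := fun u h =>
      hp (r.erase u) (Finset.erase_subset _ _) (by rw [Finset.card_erase_of_mem u.2]; omega)
        (by simpa using convexHull_mono (hsub u) h)
    rintro (_ | u) (_ | u') hne
    · exact absurd rfl hne
    · rw [pair_comm]; exact h1 u'
    · exact h1 u
    · intro h
      have hu : (u' : V) ≠ u := fun h => hne (by rw [Subtype.ext h])
      refine hpz ((r.erase u).erase u') ((Finset.erase_subset _ _).trans
        (Finset.erase_subset _ _)) ?_ (by simpa using convexHull_mono (hsub' u u') h)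
      rw [Finset.card_erase_of_mem (by simp [hu]), Finset.card_erase_of_mem u.2]
      have : 1 < r.card := Finset.one_lt_card.2 ⟨u', u'.2, u, u.2, hu⟩
      omega)
  convert key using 1
  symm
  refine Finset.card_bij (fun o _ => o.elim ∅ fun u => r.erase u) ?_ ?_ ?_
  · rintro (_ | u) h
    · exact absurd (convexHull_mono hnone (by simpa using h)) hpr
    · have h : p ∈ convexHull ℝ (x '' {some u}ᶜ) := by simpa using h
      rw [hsome] at h
      simp only [Finset.mem_filter, Finset.mem_powersetCard]
      exact ⟨⟨Finset.erase_subset _ _, by simp [Finset.card_erase_of_mem u.2, hr]⟩, by simpa using h⟩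
  · rintro (_ | u) h (_ | u') h' heq
    · rfl
    · exact absurd (convexHull_mono hnone (by simpa using h)) hpr
    · exact absurd (convexHull_mono hnone (by simpa using h')) hpr
    · rw [Option.some_inj, Subtype.ext_iff]
      exact Finset.erase_injOn r u.2 u'.2 heq
  · intro s hs
    simp only [Finset.mem_filter, Finset.mem_powersetCard] at hs
    obtain ⟨⟨hsr, hsc⟩, hps⟩ := hs
    obtain ⟨u, hu⟩ : (r \ s).Nonempty := by
      rw [← Finset.card_pos, Finset.card_sdiff_of_subset hsr]; omega
    have hu' := Finset.mem_sdiff.1 hu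
    have hs : s = r.erase u := Finset.eq_of_subset_of_card_le
      (fun a ha => Finset.mem_erase.2 ⟨fun h => hu'.2 (h ▸ ha), hsr ha⟩)
      (by rw [Finset.card_erase_of_mem hu'.1]; omega)
    refine ⟨some ⟨u, hu'.1⟩, ?_, hs.symm⟩
    simp only [Finset.mem_filter, Finset.mem_univ, true_and, hsome]
    simpa [hs] using hps

/-! ### General position -/

theorem affineSpan_ne_top_of_ncard_le {E : Type*} [NormedAddCommGroup E] [NormedSpace ℝ E]
    {A : Set E} (hA : A.Finite)
    (hc : A.ncard ≤ Module.finrank ℝ E) : affineSpan ℝ A ≠ ⊤ := by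
  classical
  intro h
  obtain ⟨F, rfl⟩ := hA.exists_finset_coe
  rw [Set.ncard_coe_finset] at hc
  rcases F.eq_empty_or_nonempty with rfl | hne
  · simp at h
  · have h1 := finrank_vectorSpan_image_finset_le ℝ (id : E → E) F (n := F.card - 1)
      (by have := hne.card_pos; omega)
    have h2 : vectorSpan ℝ (F : Set E) = ⊤ := by
      rw [← direction_affineSpan, h, AffineSubspace.direction_top]
    rw [Finset.image_id, h2, finrank_top] at h1
    have := hne.card_pos
    omega

section NormedSpace

variable {V E : Type*} [NormedAddCommGroup E] [NormedSpace ℝ E] [FiniteDimensional ℝ E]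

/-- A nonempty open set is not covered by finitely many proper affine subspaces. -/
theorem exists_mem_forall_notMem_affineSpan {U : Set E} (hU : IsOpen U) (hne : U.Nonempty)
    {𝓕 : Set (Set E)} (h𝓕 : 𝓕.Finite) (h : ∀ A ∈ 𝓕, affineSpan ℝ A ≠ ⊤) :
    ∃ x ∈ U, ∀ A ∈ 𝓕, x ∉ affineSpan ℝ A := by
  let _ : MeasurableSpace E := borel E
  have : BorelSpace E := ⟨rfl⟩
  have hnull : MeasureTheory.Measure.addHaar (⋃ A ∈ 𝓕, (affineSpan ℝ A : Set E)) = 0 :=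
    (MeasureTheory.measure_biUnion_null_iff h𝓕.countable).2 fun A hA =>
      MeasureTheory.Measure.addHaar_affineSubspace _ _ (h A hA)
  by_contra! hcov
  have : U ⊆ ⋃ A ∈ 𝓕, (affineSpan ℝ A : Set E) := fun x hx => by
    obtain ⟨A, hA, hxA⟩ := hcov x hx
    exact mem_biUnion hA hxA
  exact (hU.measure_pos MeasureTheory.Measure.addHaar hne).ne'
    (MeasureTheory.measure_mono_null this hnull)

/-- If `y` lies in the interior of a simplex that spans a hyperplane, then so do all points of the
hyperplane that are near `y`. -/
theorem eventually_mem_convexHull_of_mem_hyperplane (g : V → E) (s : Finset V)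
    (hs : s.card = Module.finrank ℝ E) (h : E →L[ℝ] ℝ) {M : ℝ} (hM : ∀ u ∈ s, h (g u) = M)
    {o : E} (ho : h o ≠ M) {y : E} (hy : y ∈ convexHull ℝ (g '' (s : Set V)))
    (hreg : ∀ t ⊆ s, t.card < s.card → y ∉ convexHull ℝ (g '' (t : Set V))) :
    ∀ᶠ q in 𝓝 y, h q = M → q ∈ convexHull ℝ (g '' (s : Set V)) := by
  classical
  let x : s → E := fun u => g u
  have himg : g '' (s : Set V) = x '' univ := by
    ext q; simp [x]
  rw [himg] at hy ⊢
  obtain ⟨w, hw0, -, hw1, hwy⟩ := (mem_convexHull_image_iff _ _ _).1 hy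
  have hno : ∀ w' : s → ℝ, (∀ i, 0 ≤ w' i) → ∑ i, w' i = 1 → ∑ i, w' i • x i = y →
      ∀ j, w' j ≠ 0 := by
    intro w' h0 h1 h2 j hj
    refine hreg (s.erase j) (Finset.erase_subset _ _) (Finset.card_erase_lt_of_mem j.2)
      (convexHull_mono ?_ ((mem_convexHull_image_iff x {j}ᶜ y).2
        ⟨w', h0, fun i hi hij => hi (hij ▸ hj), h1, h2⟩))
    rintro _ ⟨i, hi, rfl⟩
    have : i ≠ j := hi
    exact ⟨i, by simp [this], rfl⟩
  have hxM : ∀ i, h (x i) = M := fun i => hM i i.2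
  let Φ : (s → ℝ) →ₗ[ℝ] E := ∑ i, (LinearMap.proj i).smulRight (x i - o)
  have hΦ : ∀ l, Φ l = ∑ i, l i • (x i - o) := fun l => by simp [Φ, LinearMap.sum_apply]
  have hΦ' : ∀ l, Φ l = ∑ i, l i • x i - (∑ i, l i) • o := fun l => by
    simp [hΦ, smul_sub, Finset.sum_smul]
  have hhΦ : ∀ l, h (Φ l) = (∑ i, l i) * (M - h o) := fun l => by
    simp [hΦ, hxM, Finset.sum_mul]
  have hinj : Function.Injective Φ := by
    rw [injective_iff_map_eq_zero]
    intro l hl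
    have h0 : ∑ i, l i = 0 := by
      have := hhΦ l
      rw [hl, map_zero] at this
      exact (mul_eq_zero.1 this.symm).resolve_right (sub_ne_zero.2 ho.symm)
    have hx0 : ∑ i, l i • x i = 0 := by
      have := hΦ' l
      rw [hl, h0, zero_smul, sub_zero] at this
      exact this.symm
    by_contra hne
    obtain ⟨w', h0', h1', hx', -, j, -, hj⟩ :=
      exists_weights_of_dependence x hw0 h0 hx0 (exists_neg_of_sum_eq_zero h0 hne)
    exact hno w' h0' (h1'.trans hw1) (hx'.trans hwy) j hj
  let e : (s → ℝ) ≃L[ℝ] E :=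
    (LinearMap.linearEquivOfInjective Φ hinj (by simp [hs])).toContinuousLinearEquiv
  have he : ∀ l, e l = Φ l := fun l => rfl
  have hew : e.symm (y - o) = w := by
    rw [ContinuousLinearEquiv.symm_apply_eq, he, hΦ', hwy, hw1, one_smul]
  have hcont : Continuous fun q => e.symm (q - o) := by fun_prop
  have hpos : ∀ᶠ q in 𝓝 y, ∀ i, 0 < e.symm (q - o) i := by
    refine eventually_all.2 fun i => ?_
    have hc : Continuous fun q => e.symm (q - o) i := (continuous_apply i).comp hcont
    refine hc.continuousAt.eventually_mem (Ioi_mem_nhds ?_)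
    rw [hew]
    exact lt_of_le_of_ne (hw0 i) (hno w hw0 hw1 hwy i).symm
  filter_upwards [hpos] with q hq hqM
  have hqe : Φ (e.symm (q - o)) = q - o := by rw [← he]; simp
  have hsum : ∑ i, e.symm (q - o) i = 1 := by
    have := hhΦ (e.symm (q - o))
    rw [hqe, map_sub, hqM] at this
    exact (mul_right_cancel₀ (sub_ne_zero.2 ho.symm) (by rw [one_mul]; exact this)).symm
  refine (mem_convexHull_image_iff _ _ _).2 ⟨_, fun i => (hq i).le, fun _ _ => mem_univ _, hsum, ?_⟩
  have := hΦ' (e.symm (q - o))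
  rw [hqe, hsum, one_smul] at this
  exact (sub_left_inj.1 this).symm

/-- A point `y` of the boundary of a convex body that avoids the faces of some boundary simplices
can be moved into general position without leaving or entering any of these simplices. -/
theorem exists_generic_mem_frontier [Fintype V] {P : Set E} (hP : Convex ℝ P) (hPc : IsClosed P)
    (hPi : (interior P).Nonempty) (g : V → E) (𝓢 : Set (Finset V))
    (hcard : ∀ s ∈ 𝓢, s.card = Module.finrank ℝ E)
    (hfr : ∀ s ∈ 𝓢, convexHull ℝ (g '' (s : Set V)) ⊆ frontier P)
    {y : E} (hreg : ∀ s ∈ 𝓢, ∀ t ⊆ s, t.card < s.card → y ∉ convexHull ℝ (g '' (t : Set V)))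
    (hy : ∃ s ∈ 𝓢, y ∈ convexHull ℝ (g '' (s : Set V))) :
    ∃ y' ∈ frontier P,
      (∀ t : Finset V, t.card < Module.finrank ℝ E → y' ∉ convexHull ℝ (g '' (t : Set V))) ∧
      ∀ s ∈ 𝓢, y' ∈ convexHull ℝ (g '' (s : Set V)) ↔ y ∈ convexHull ℝ (g '' (s : Set V)) := by
  classical
  obtain ⟨s₀, hs₀, hys₀⟩ := hy
  have hyfr := hfr s₀ hs₀ hys₀
  obtain ⟨o, ho⟩ := hPi
  obtain ⟨h, hh⟩ := geometric_hahn_banach_open_point hP.interior isOpen_interior hyfr.2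
  have hho := hh o ho
  have hle : ∀ a ∈ P, h a ≤ h y := by
    intro a ha
    have : a ∈ closure (interior P) := by
      rw [hP.closure_interior_eq_closure_of_nonempty_interior ⟨o, ho⟩]
      exact subset_closure ha
    exact closure_minimal (fun b hb => (hh b hb).le)
      (isClosed_le h.continuous continuous_const) this
  -- the simplices that contain `y` lie in the supporting hyperplane at `y`
  have hface : ∀ s ∈ 𝓢, y ∈ convexHull ℝ (g '' (s : Set V)) → ∀ u ∈ s, h (g u) = h y := by
    intro s hs hys u hu
    obtain ⟨w, hw0, hws, hw1, hwy⟩ := (mem_convexHull_image_iff _ _ _).1 hys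
    have hwu : w u ≠ 0 := fun h0 => hreg s hs (s.erase u) (Finset.erase_subset _ _)
      (Finset.card_erase_lt_of_mem hu) ((mem_convexHull_image_iff _ _ _).2
        ⟨w, hw0, fun i hi =>
          Finset.mem_coe.2 (Finset.mem_erase.2 ⟨fun hiu => hi (by rw [hiu, h0]), hws i hi⟩), hw1, hwy⟩)
    have hnn : ∀ i, 0 ≤ w i * (h y - h (g i)) := by
      intro i
      by_cases hi : w i = 0
      · simp [hi]
      · refine mul_nonneg (hw0 i) (sub_nonneg.2 (hle _ (hPc.frontier_subset
          (hfr s hs (subset_convexHull ℝ _ ⟨i, hws i hi, rfl⟩)))))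
    have hsum : ∑ i, w i * (h y - h (g i)) = 0 := by
      have : h (∑ i, w i • g i) = h y := by rw [hwy]
      simp only [map_sum, map_smul, smul_eq_mul] at this
      simp [mul_sub, Finset.sum_sub_distrib, ← Finset.sum_mul, hw1, this]
    have := (Finset.sum_eq_zero_iff_of_nonneg fun i _ => hnn i).1 hsum u (Finset.mem_univ u)
    have := (mul_eq_zero.1 this).resolve_left hwu
    linarith
  -- the central projection from `o` to this hyperplane
  let F : E → E := fun q => o + ((h y - h o) / (h q - h o)) • (q - o)
  have hFy : F y = y := by
    have : h y - h o ≠ 0 := by linarith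
    simp [F, div_self this]
  have hFc : Tendsto F (𝓝 y) (𝓝 y) := by
    have : ContinuousAt F y := by
      have h1 : h y - h o ≠ 0 := by linarith
      fun_prop (disch := exact h1)
    simpa [ContinuousAt, hFy] using this
  have hev1 : ∀ᶠ q in 𝓝 y, h o < h q :=
    h.continuous.continuousAt.eventually_mem (Ioi_mem_nhds hho)
  have hev2 : ∀ᶠ q in 𝓝 y, ∀ s : Finset V, s ∈ 𝓢 → (h (F q) = h y →
      (F q ∈ convexHull ℝ (g '' (s : Set V)) ↔ y ∈ convexHull ℝ (g '' (s : Set V)))) := by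
    refine eventually_all.2 fun s => ?_
    by_cases hs : s ∈ 𝓢
    swap
    · simp [hs]
    by_cases hys : y ∈ convexHull ℝ (g '' (s : Set V))
    · filter_upwards [hFc.eventually (eventually_mem_convexHull_of_mem_hyperplane g s (hcard s hs) h
        (hface s hs hys) hho.ne hys (hreg s hs))] with q hq _ hqM
      exact iff_of_true (hq hqM) hys
    · have hcl : IsClosed (convexHull ℝ (g '' (s : Set V))) :=
        ((s.finite_toSet.image g).isCompact_convexHull (𝕜 := ℝ)).isClosed
      filter_upwards [hFc.eventually (hcl.isOpen_compl.mem_nhds hys)] with q hq _ _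
      exact iff_of_false hq hys
  obtain ⟨U, hU, hUo, hyU⟩ := eventually_nhds_iff.1 (hev1.and hev2)
  -- `F q` lies on a simplex only if `q` lies on its join with `o`
  obtain ⟨q, hqU, hq⟩ := exists_mem_forall_notMem_affineSpan hUo ⟨y, hyU⟩
    (𝓕 := (fun t : Finset V => insert o (g '' (t : Set V))) ''
      {t | t.card < Module.finrank ℝ E}) (Set.toFinite _) (by
      rintro _ ⟨t, ht, rfl⟩
      have ht : t.card < Module.finrank ℝ E := ht
      refine affineSpan_ne_top_of_ncard_le (Set.toFinite _) ((ncard_insert_le _ _).trans ?_)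
      have := (Set.ncard_image_le (f := g) t.finite_toSet)
      rw [Set.ncard_coe_finset] at this
      omega)
  obtain ⟨hq1, hq2⟩ := hU q hqU
  have hFM : h (F q) = h y := by
    have : h q - h o ≠ 0 := by linarith
    simp only [F, map_add, map_smul, map_sub, smul_eq_mul]
    field_simp
    ring
  refine ⟨F q, hfr s₀ hs₀ ((hq2 s₀ hs₀ hFM).2 hys₀), fun t ht hFt => ?_, fun s hs => hq2 s hs hFM⟩
  refine hq _ ⟨t, ht, rfl⟩ ?_
  have h1 : F q ∈ affineSpan ℝ (insert o (g '' (t : Set V))) :=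
    affineSpan_mono ℝ (subset_insert _ _) (convexHull_subset_affineSpan _ hFt)
  have h2 : o ∈ affineSpan ℝ (insert o (g '' (t : Set V))) :=
    mem_affineSpan ℝ (mem_insert _ _)
  have h3 : q = AffineMap.lineMap o (F q) ((h q - h o) / (h y - h o)) := by
    have h4 : h q - h o ≠ 0 := by linarith
    have h5 : h y - h o ≠ 0 := by linarith
    have : (h q - h o) / (h y - h o) * ((h y - h o) / (h q - h o)) = 1 := by field_simp
    simp [F, AffineMap.lineMap_apply, smul_smul, this]
  rw [h3]
  exact AffineMap.lineMap_mem _ h2 h1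

end NormedSpace

/-! ### Boundary parity of a chain that misses an interior point -/

section Crossing

variable {V E : Type*}

open Classical in
theorem exists_image_erase_eq_image {g : V → E} {s : Finset V} (hg : ¬ InjOn g (s : Set V)) :
    ∃ u ∈ s, g '' (s.erase u : Set V) = g '' (s : Set V) := by
  simp only [InjOn, not_forall] at hg
  obtain ⟨a, ha, b, hb, hab, hne⟩ := hg
  refine ⟨a, ha, (image_mono (by simp)).antisymm ?_⟩
  rintro _ ⟨c, hc, rfl⟩
  by_cases hca : c = a
  · exact ⟨b, by simpa [Ne.symm hne] using hb, by rw [hca, hab]⟩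
  · exact ⟨c, by simpa [hca] using hc, rfl⟩

/-- A regular point of the boundary lies only on simplices whose vertices have distinct images. -/
theorem injOn_of_mem_convexHull [AddCommGroup E] [Module ℝ E] {g : V → E} {s : Finset V} {y : E}
    (hreg : ∀ t ⊆ s, t.card < s.card → y ∉ convexHull ℝ (g '' (t : Set V)))
    (hy : y ∈ convexHull ℝ (g '' (s : Set V))) : InjOn g (s : Set V) := by
  classical
  by_contra hg
  obtain ⟨u, hu, he⟩ := exists_image_erase_eq_image hg
  exact hreg _ (Finset.erase_subset _ _) (Finset.card_erase_lt_of_mem hu) (he ▸ hy)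

variable [NormedAddCommGroup E] [NormedSpace ℝ E]

theorem exists_mem_segment_of_mem_convexHull_insert {z p : E} {A : Set E} (hzp : p ≠ z)
    (h : p ∈ convexHull ℝ (insert z A)) :
    ∃ x ∈ convexHull ℝ A, ∃ a b : ℝ, 0 ≤ a ∧ 0 < b ∧ a + b = 1 ∧ a • z + b • x = p := by
  rcases A.eq_empty_or_nonempty with rfl | hA
  · simp at h
    exact absurd h hzp
  · rw [convexHull_insert hA, mem_convexJoin] at h
    obtain ⟨_, rfl, x, hx, a, b, ha, hb, hab, rfl⟩ := h
    refine ⟨x, hx, a, b, ha, lt_of_le_of_ne hb ?_, hab, rfl⟩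
    rintro rfl
    have : a = 1 := by linarith
    simp [this] at hzp

open Classical in
/-- The image of a chain `C` of `d`-simplices misses some interior points of a convex body, while
its mod 2 boundary is mapped to the boundary of the convex body. Then a point of the boundary in
general position lies on an even number of simplices of the mod 2 boundary of `C`. -/
theorem even_card_boundary_of_disjoint [FiniteDimensional ℝ E] [Fintype V] {P U : Set E}
    (hP : Convex ℝ P) (hUo : IsOpen U) (hUne : U.Nonempty)
    (hUP : U ⊆ interior P) (g : V → E) (C : Finset (Finset V))
    (hC : ∀ r ∈ C, r.card = Module.finrank ℝ E + 1)
    (hUC : ∀ r ∈ C, ∀ p ∈ U, p ∉ convexHull ℝ (g '' (r : Set V)))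
    {y : E} (hy : y ∈ frontier P)
    (hgen : ∀ t : Finset V, t.card < Module.finrank ℝ E → y ∉ convexHull ℝ (g '' (t : Set V)))
    (hfr : ∀ s : Finset V, s.card = Module.finrank ℝ E → InjOn g (s : Set V) →
      Odd (C.filter fun r => s ⊆ r).card → convexHull ℝ (g '' (s : Set V)) ⊆ frontier P) :
    Even ((Finset.univ.powersetCard (Module.finrank ℝ E)).filter fun s : Finset V =>
      Odd (C.filter fun r => s ⊆ r).card ∧ y ∈ convexHull ℝ (g '' (s : Set V))).card := by
  set d := Module.finrank ℝ E with hd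
  have hncard : ∀ t : Finset V, (g '' (t : Set V)).ncard ≤ t.card := fun t => by
    have := (Set.ncard_image_le (f := g) t.finite_toSet)
    rwa [Set.ncard_coe_finset] at this
  obtain ⟨p, hpU, hp⟩ := exists_mem_forall_notMem_affineSpan hUo hUne
    (𝓕 := ((fun t : Finset V => g '' (t : Set V)) '' {t | t.card ≤ d}) ∪
      ((fun t : Finset V => insert y (g '' (t : Set V))) '' {t | t.card < d})) (Set.toFinite _) (by
      rintro _ (⟨t, ht, rfl⟩ | ⟨t, ht, rfl⟩)
      · exact affineSpan_ne_top_of_ncard_le (Set.toFinite _) ((hncard t).trans ht)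
      · refine affineSpan_ne_top_of_ncard_le (Set.toFinite _) ((ncard_insert_le _ _).trans ?_)
        have ht : t.card < d := ht
        have := hncard t
        omega)
  have hp1 : ∀ t : Finset V, t.card ≤ d → p ∉ convexHull ℝ (g '' (t : Set V)) := fun t ht h =>
    hp _ (Or.inl ⟨t, ht, rfl⟩) (convexHull_subset_affineSpan _ h)
  have hpint := hUP hpU
  have hpy : p ≠ y := fun h => hy.2 (h ▸ hpint)
  -- the apex `z` lies beyond `p` on the ray from `y` through `p`
  set z := p + (p - y) with hzdef
  have hzp : p ≠ z := by
    simp [hzdef, sub_eq_zero, hpy]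
  have hjoin : ∀ A : Set E, p ∈ convexHull ℝ (insert z A) → ∃ x ∈ convexHull ℝ A,
      ∃ a b : ℝ, 0 ≤ a ∧ 0 < b ∧ (b - a) • p = b • x - a • y := by
    intro A hA
    obtain ⟨x, hx, a, b, ha, hb, hab, h⟩ := exists_mem_segment_of_mem_convexHull_insert hzp hA
    refine ⟨x, hx, a, b, ha, hb, ?_⟩
    have hb' : b = 1 - a := by linarith
    subst hb'
    have h' : (1 - a) • x = p - a • z := by rw [← h]; abel
    rw [h', hzdef]
    module
  have hp2 : ∀ t : Finset V, t.card < d → p ∉ convexHull ℝ (insert z (g '' (t : Set V))) := by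
    intro t ht h
    obtain ⟨x, hx, a, b, ha, hb, heq⟩ := hjoin _ h
    by_cases hc : b - a = 0
    · rw [hc, zero_smul, ← sub_eq_zero.1 hc, ← smul_sub, eq_comm, smul_eq_zero, sub_eq_zero] at heq
      exact hgen t ht (heq.resolve_left hb.ne' ▸ hx)
    · refine hp _ (Or.inr ⟨t, ht, rfl⟩) ?_
      have hpx : p = AffineMap.lineMap y x (b / (b - a)) := by
        apply smul_right_injective E hc
        simp only [AffineMap.lineMap_apply, vsub_eq_sub, vadd_eq_add, heq, smul_add, smul_smul,
          mul_div_cancel₀ b hc]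
        module
      rw [hpx]
      exact AffineMap.lineMap_mem _ (mem_affineSpan ℝ (mem_insert _ _))
        (affineSpan_mono ℝ (subset_insert _ _) (convexHull_subset_affineSpan _ hx))
  -- the ray from `z` through `p` leaves the convex body at `y` only
  have hiff : ∀ s : Finset V, convexHull ℝ (g '' (s : Set V)) ⊆ frontier P →
      (p ∈ convexHull ℝ (insert z (g '' (s : Set V))) ↔ y ∈ convexHull ℝ (g '' (s : Set V))) := by
    intro s hs
    constructor
    · intro h
      obtain ⟨x, hx, a, b, ha, hb, heq⟩ := hjoin _ h
      have hxfr := hs hx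
      rcases lt_trichotomy (b - a) 0 with hc | hc | hc
      · have ha' : 0 < a := by linarith
        have hyx : y = ((a - b) / a) • p + (b / a) • x := by
          apply smul_right_injective E ha'.ne'
          simp only [smul_add, smul_smul, mul_div_cancel₀ _ ha'.ne']
          have : (a - b) • p = a • y - b • x := by
            rw [← neg_sub b, neg_smul, heq]; abel
          rw [this]; abel
        exact absurd (hyx ▸ hP.combo_interior_closure_mem_interior hpint
          (frontier_subset_closure hxfr) (div_pos (by linarith) ha') (by positivity)
          (by field_simp; ring)) hy.2
      · rw [hc, zero_smul, ← sub_eq_zero.1 hc, ← smul_sub, eq_comm, smul_eq_zero,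
          sub_eq_zero] at heq
        exact heq.resolve_left hb.ne' ▸ hx
      · have hxy : x = ((b - a) / b) • p + (a / b) • y := by
          apply smul_right_injective E hb.ne'
          simp only [smul_add, smul_smul, mul_div_cancel₀ _ hb.ne', heq]
          abel
        exact absurd (hxy ▸ hP.combo_interior_closure_mem_interior hpint
          (frontier_subset_closure hy) (div_pos hc hb) (by positivity)
          (by field_simp; ring)) hxfr.2
    · intro h
      have hpz : p = (1 / 2 : ℝ) • z + (1 / 2 : ℝ) • y := by
        rw [hzdef]
        module
      rw [hpz]
      exact convex_convexHull ℝ _ (subset_convexHull ℝ _ (mem_insert _ _))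
        (convexHull_mono (subset_insert _ _) h) (by norm_num) (by norm_num) (by norm_num)
  -- sum the parity statement for the joins with `z` over the simplices of `C`
  have heven : Even (∑ r ∈ C, ((r.powersetCard d).filter fun s : Finset V =>
      p ∈ convexHull ℝ (insert z (g '' (s : Set V)))).card) :=
    Finset.even_sum _ fun r hr => even_card_facets_join g r (hC r hr) p z (fun t _ => hp1 t)
      (fun t _ => hp2 t) (hUC r hr p hpU)
  have hswap : ∑ r ∈ C, ((r.powersetCard d).filter fun s : Finset V =>
      p ∈ convexHull ℝ (insert z (g '' (s : Set V)))).card =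
      ∑ s ∈ (Finset.univ.powersetCard d).filter fun s : Finset V =>
        p ∈ convexHull ℝ (insert z (g '' (s : Set V))), (C.filter fun r => s ⊆ r).card := by
    refine Eq.trans ?_
      (Finset.sum_card_bipartiteAbove_eq_sum_card_bipartiteBelow fun r s : Finset V => s ⊆ r)
    refine Finset.sum_congr rfl fun r _ => congrArg _ ?_
    ext s
    simp only [Finset.bipartiteAbove, Finset.mem_filter, Finset.mem_powersetCard,
      Finset.subset_univ, true_and]
    tauto
  rw [hswap, Finset.even_sum_iff_even_card_odd, Finset.filter_filter] at heven
  convert heven using 2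
  refine Finset.filter_congr fun s hs => ?_
  have hsc : s.card = d := (Finset.mem_powersetCard.1 hs).2
  constructor
  · rintro ⟨ho, hys⟩
    have hinj := injOn_of_mem_convexHull (fun t _ ht => hgen t (hsc ▸ ht)) hys
    exact ⟨(hiff s (hfr s hsc hinj ho)).2 hys, ho⟩
  · rintro ⟨hps, ho⟩
    have hinj : InjOn g (s : Set V) := by
      by_contra hg
      obtain ⟨u, hu, he⟩ := exists_image_erase_eq_image hg
      exact hp2 _ (hsc ▸ Finset.card_erase_lt_of_mem hu) (he ▸ hps)
    exact ⟨ho, (hiff s (hfr s hsc hinj ho)).1 hps⟩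

end Crossing

/-! ### Components and their labels -/

section Chains

variable {V : Type*} {ι : Type*}

/-- The simplices `r` and `r'` share a `(d-1)`-simplex (a simplex with `d` vertices) whose labels
are pairwise distinct. -/
def SharesRainbowFacet (L : V → ι) (d : ℕ) (r r' : Finset V) : Prop :=
  ∃ s : Finset V, s.card = d ∧ InjOn L (s : Set V) ∧ s ⊆ r ∧ s ⊆ r'

theorem SharesRainbowFacet.symm {L : V → ι} {d : ℕ} {r r' : Finset V}
    (h : SharesRainbowFacet L d r r') : SharesRainbowFacet L d r' r := by
  obtain ⟨s, hc, hi, h1, h2⟩ := h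
  exact ⟨s, hc, hi, h2, h1⟩

/-- The collection `C` contains every simplex of `K` that shares a facet with pairwise distinct
labels with one of its members: it is a union of components of `K` for this adjacency. -/
def IsClosedIn (L : V → ι) (d : ℕ) (C K : Finset (Finset V)) : Prop :=
  ∀ r ∈ C, ∀ r' ∈ K, SharesRainbowFacet L d r r' → r' ∈ C

open Classical in
/-- A connected collection of `d`-simplices in which `k` simplices are fully labelled carries at
most `d + k` labels: a simplex adjacent to others contributes a new label only if it is fully labelled,
and then only one. -/
theorem card_labels_le_of_connected (L : V → ι) (d : ℕ) (C : Finset (Finset V))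
    (hC : ∀ r ∈ C, r.card = d + 1)
    (hconn : ∀ D ⊆ C, D.Nonempty → IsClosedIn L d D C → D = C) :
    ((C.biUnion id).image L).card ≤ d + (C.filter fun r : Finset V => InjOn L (r : Set V)).card := by
  rcases C.eq_empty_or_nonempty with rfl | ⟨r₀, hr₀⟩
  · simp
  have hr : ∀ r ∈ C, (r.image L).card ≤ d + if InjOn L (r : Set V) then 1 else 0 := by
    intro r hr
    have h1 := hC r hr
    split_ifs with h
    · rw [Finset.card_image_of_injOn h, h1]
    · have h2 : (r.image L).card ≤ r.card := Finset.card_image_le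
      have h3 : (r.image L).card ≠ r.card := fun h' => h (Finset.card_image_iff.1 h')
      omega
  obtain ⟨D, hD, hmax⟩ := Finset.exists_max_image
    (C.powerset.filter fun D => D.Nonempty ∧
      ((D.biUnion id).image L).card ≤ d + (D.filter fun r : Finset V => InjOn L (r : Set V)).card)
    Finset.card ⟨{r₀}, by
      have := hr r₀ hr₀
      simp only [Finset.mem_filter, Finset.mem_powerset, Finset.singleton_subset_iff, hr₀,
        Finset.singleton_nonempty, true_and, Finset.singleton_biUnion, id]
      rwa [Finset.filter_singleton, apply_ite Finset.card, Finset.card_singleton,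
        Finset.card_empty]⟩
  simp only [Finset.mem_filter, Finset.mem_powerset] at hD hmax
  obtain ⟨hDC, hDne, hDc⟩ := hD
  suffices h : D = C by rwa [h] at hDc
  by_contra hne
  have hncl : ¬ IsClosedIn L d D C := fun h => hne (hconn D hDC hDne h)
  simp only [IsClosedIn, not_forall] at hncl
  obtain ⟨r, hrD, r', hr'C, ⟨s, hsc, hsL, hsr, hsr'⟩, hr'D⟩ := hncl
  have hcard := hmax (insert r' D) ⟨Finset.insert_subset hr'C hDC, Finset.insert_nonempty _ _, ?_⟩
  · rw [Finset.card_insert_of_notMem hr'D] at hcard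
    omega
  rw [Finset.biUnion_insert, Finset.image_union]
  have h1 : (r'.image L \ (D.biUnion id).image L).card ≤ if InjOn L (r' : Set V) then 1 else 0 := by
    have hsub : s.image L ⊆ r'.image L := Finset.image_subset_image hsr'
    have h2 : r'.image L \ (D.biUnion id).image L ⊆ r'.image L \ s.image L :=
      Finset.sdiff_subset_sdiff subset_rfl
        (Finset.image_subset_image (hsr.trans (Finset.subset_biUnion_of_mem id hrD)))
    have h3 := Finset.card_le_card h2
    rw [Finset.card_sdiff_of_subset hsub, Finset.card_image_of_injOn hsL, hsc] at h3
    have := hr r' hr'C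
    omega
  have h2 : ((insert r' D).filter fun r : Finset V => InjOn L (r : Set V)).card =
      (D.filter fun r : Finset V => InjOn L (r : Set V)).card + if InjOn L (r' : Set V) then 1 else 0 := by
    rw [Finset.filter_insert]
    split_ifs
    · rw [Finset.card_insert_of_notMem (by simp [hr'D])]
    · rfl
  have h3 := Finset.card_sdiff_add_card (r'.image L) ((D.biUnion id).image L)
  simp only [id] at h3 ⊢
  omega

open Classical in
/-- If an odd number of facets with pairwise distinct labels is given, then some component of `K`
contains an odd number of them. -/
theorem exists_odd_component (L : V → ι) (d : ℕ) (K S : Finset (Finset V))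
    (hS : ∀ s ∈ S, s.card = d ∧ InjOn L (s : Set V) ∧ ∃ r ∈ K, s ⊆ r) (hodd : Odd S.card) :
    ∃ C ⊆ K, IsClosedIn L d C K ∧ (∀ D ⊆ C, D.Nonempty → IsClosedIn L d D C → D = C) ∧
      Odd (S.filter fun s => ∃ r ∈ C, s ⊆ r).card := by
  obtain ⟨C, hC, hmin⟩ := Finset.exists_min_image
    (K.powerset.filter fun C => IsClosedIn L d C K ∧
      Odd (S.filter fun s => ∃ r ∈ C, s ⊆ r).card)
    Finset.card ⟨K, by
      simp only [Finset.mem_filter, Finset.mem_powerset, subset_rfl, true_and]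
      refine ⟨fun _ _ _ h _ => h, ?_⟩
      rwa [Finset.filter_true_of_mem fun s hs => (hS s hs).2.2]⟩
  simp only [Finset.mem_filter, Finset.mem_powerset] at hC hmin
  obtain ⟨hCK, hcl, hCodd⟩ := hC
  refine ⟨C, hCK, hcl, fun D hDC hDne hD => ?_, hCodd⟩
  by_contra hne
  have hD' : IsClosedIn L d D K := fun r hr r' hr' h => hD r hr r' (hcl r (hDC hr) r' hr' h) h
  have hE' : IsClosedIn L d (C \ D) K := fun r hr r' hr' h => by
    rw [Finset.mem_sdiff] at hr ⊢
    exact ⟨hcl r hr.1 r' hr' h, fun h' => hr.2 (hD r' h' r hr.1 h.symm)⟩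
  have hsum : (S.filter fun s => ∃ r ∈ C, s ⊆ r).card =
      (S.filter fun s => ∃ r ∈ D, s ⊆ r).card + (S.filter fun s => ∃ r ∈ C \ D, s ⊆ r).card := by
    rw [← Finset.card_union_of_disjoint]
    · congr 1
      ext s
      simp only [Finset.mem_filter, Finset.mem_union, Finset.mem_sdiff]
      constructor
      · rintro ⟨hs, r, hr, hsr⟩
        by_cases h : r ∈ D
        · exact Or.inl ⟨hs, r, h, hsr⟩
        · exact Or.inr ⟨hs, r, ⟨hr, h⟩, hsr⟩
      · rintro (⟨hs, r, hr, hsr⟩ | ⟨hs, r, hr, hsr⟩)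
        · exact ⟨hs, r, hDC hr, hsr⟩
        · exact ⟨hs, r, hr.1, hsr⟩
    · rw [Finset.disjoint_left]
      intro s h1 h2
      simp only [Finset.mem_filter, Finset.mem_sdiff] at h1 h2
      obtain ⟨hs, r, hr, hsr⟩ := h1
      obtain ⟨-, r', hr', hsr'⟩ := h2
      exact hr'.2 (hD r hr r' hr'.1 ⟨s, (hS s hs).1, (hS s hs).2.1, hsr, hsr'⟩)
  have hlt : D.card < C.card := Finset.card_lt_card (hDC.ssubset_of_ne hne)
  have hlt' : (C \ D).card < C.card := by
    have := hDne.card_pos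
    rw [Finset.card_sdiff_of_subset hDC]
    omega
  rw [hsum, Nat.odd_add] at hCodd
  by_cases h : Odd (S.filter fun s => ∃ r ∈ D, s ⊆ r).card
  · exact absurd (hmin D ⟨hDC.trans hCK, hD', h⟩) (by omega)
  · have h2 : Odd (S.filter fun s => ∃ r ∈ C \ D, s ⊆ r).card := by
      rw [← Nat.not_even_iff_odd]
      exact fun he => h (hCodd.2 he)
    exact absurd (hmin (C \ D) ⟨Finset.sdiff_subset.trans hCK, hE', h2⟩) (by omega)

end Chains

/-! ### The mod 2 degree and the count of fully labelled simplices -/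

section Degree

variable {V : Type*} [Fintype V] {m : ℕ} {E : Type*} [AddCommGroup E] [Module ℝ E]

/-- The `(d-1)`-simplices (with `d` vertices) of the mod 2 boundary of the `d`-complex `K`. -/
def bdFacets (K : PreAbstractSimplicialComplex V) (d : ℕ) : Set (Finset V) :=
  {s | s ∈ K.faces ∧ s.card = d ∧ Odd {r : Finset V | r ∈ K.faces ∧ r.card = d + 1 ∧ s ⊆ r}.ncard}

variable {K : PreAbstractSimplicialComplex V} {d : ℕ} {v : Fin m → E} {L : V → Fin m} {y : E}

/-- The image under the simplexwise affine map of the closed simplex with vertex set `s`. -/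
theorem mem_convexHull_iff_labelMap (s : Finset V) :
    y ∈ convexHull ℝ ((v ∘ L) '' (s : Set V)) ↔
      ∃ w ∈ stdSimplex ℝ V, (∀ u, w u ≠ 0 → u ∈ s) ∧ labelMap v L w = y := by
  rw [mem_convexHull_image_iff]
  constructor
  · rintro ⟨w, h0, hs, h1, hy⟩
    exact ⟨w, ⟨h0, h1⟩, hs, hy⟩
  · rintro ⟨w, ⟨h0, h1⟩, hs, hy⟩
    exact ⟨w, h0, hs, h1, hy⟩

theorem convexHull_subset_image_space_Bd {s : Finset V} (hs : s ∈ bdFacets K d) :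
    convexHull ℝ ((v ∘ L) '' (s : Set V)) ⊆ labelMap v L '' space (Bd K d) := by
  intro y hy
  obtain ⟨w, hw, hws, rfl⟩ := (mem_convexHull_iff_labelMap s).1 hy
  exact ⟨w, ⟨hw, s, ⟨(K.isRelLowerSet_faces hs.1).1, s, hs.1, hs.2.1, hs.2.2, subset_rfl⟩, hws⟩, rfl⟩

theorem IsRegularValue.notMem_convexHull {S : Set E}
    (hy : IsRegularValue (Bd K d) (d - 1) (labelMap v L) S y) {s : Finset V}
    (hs : s ∈ bdFacets K d) {t : Finset V} (hts : t ⊆ s) (htc : t.card < s.card) :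
    y ∉ convexHull ℝ ((v ∘ L) '' (t : Set V)) := by
  intro h
  obtain ⟨w, hw, hwt, hwy⟩ := (mem_convexHull_iff_labelMap t).1 h
  refine hy.2 ⟨w, ⟨hw, t, ⟨⟨?_, s, hs.1, hs.2.1, hs.2.2, hts⟩, ?_⟩, hwt⟩, hwy⟩
  · rcases t.eq_empty_or_nonempty with rfl | ht
    · simp at h
    · exact ht
  · have := hs.2.1
    omega

open Classical in
/-- The preimages of a regular value correspond to the facets whose images contain it: a preimage
has all the vertices of such a facet as its support, and the facet determines the preimage. -/
theorem IsRegularValue.ncard_preimage {S : Set E}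
    (hy : IsRegularValue (Bd K d) (d - 1) (labelMap v L) S y) :
    {w | w ∈ space (Bd K d) ∧ labelMap v L w = y}.ncard =
      {s | s ∈ bdFacets K d ∧ y ∈ convexHull ℝ ((v ∘ L) '' (s : Set V))}.ncard := by
  have hsupp : ∀ w ∈ stdSimplex ℝ V, labelMap v L w = y → ∀ s ∈ bdFacets K d,
      (∀ u, w u ≠ 0 → u ∈ s) → (Finset.univ.filter fun u => w u ≠ 0) = s := by
    intro w hw hwy s hs hws
    have hsub : (Finset.univ.filter fun u => w u ≠ 0) ⊆ s := fun u hu => hws u (by simpa using hu)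
    refine Finset.eq_of_subset_of_card_le hsub (not_lt.1 fun hlt => ?_)
    exact hy.notMem_convexHull hs hsub hlt
      ((mem_convexHull_iff_labelMap _).2 ⟨w, hw, fun u hu => by simpa using hu, hwy⟩)
  refine Set.ncard_congr (fun w _ => Finset.univ.filter fun u => w u ≠ 0) ?_ ?_ ?_
  · rintro w ⟨⟨hw, t, ⟨-, s, hsK, hsc, hso, hts⟩, hwt⟩, hwy⟩
    have hs : s ∈ bdFacets K d := ⟨hsK, hsc, hso⟩
    have hws : ∀ u, w u ≠ 0 → u ∈ s := fun u hu => hts (hwt u hu)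
    rw [hsupp w hw hwy s hs hws]
    exact ⟨hs, (mem_convexHull_iff_labelMap s).2 ⟨w, hw, hws, hwy⟩⟩
  · rintro w w' ⟨⟨hw, t, ⟨-, s, hsK, hsc, hso, hts⟩, hwt⟩, hwy⟩ ⟨⟨hw', -⟩, hwy'⟩ heq
    have hs : s ∈ bdFacets K d := ⟨hsK, hsc, hso⟩
    have hws : ∀ u, w u ≠ 0 → u ∈ s := fun u hu => hts (hwt u hu)
    have hws' : ∀ u, w' u ≠ 0 → u ∈ s := fun u hu => hws u (by
      have : u ∈ Finset.univ.filter fun u => w' u ≠ 0 := by simpa using hu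
      rw [← heq] at this
      simpa using this)
    by_contra hne
    have hd0 : ∑ u, (w u - w' u) = 0 := by rw [Finset.sum_sub_distrib, hw.2, hw'.2, sub_self]
    obtain ⟨w'', h0, h1, hx, hfix, j, hj, hj0⟩ := exists_weights_of_dependence (v ∘ L)
      (μ := fun u => w u - w' u) hw.1 hd0 (by
        have h1 : ∑ u, w u • v (L u) = y := hwy
        have h2 : ∑ u, w' u • v (L u) = y := hwy'
        simp [sub_smul, Finset.sum_sub_distrib, h1, h2])
      (exists_neg_of_sum_eq_zero hd0 fun h => hne (funext fun u => sub_eq_zero.1 (congrFun h u)))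
    have hws'' : ∀ u, w'' u ≠ 0 → u ∈ s := fun u hu => by
      by_contra hus
      have hwu : w u = 0 := by_contra fun h => hus (hws u h)
      have hwu' : w' u = 0 := by_contra fun h => hus (hws' u h)
      exact hu ((hfix u (by simp [hwu, hwu'])).trans hwu)
    have hjs : j ∈ s := hws' j fun h => by
      have := hw.1 j
      simp only [h] at hj
      linarith
    have hw'' : w'' ∈ stdSimplex ℝ V := ⟨h0, h1.trans hw.2⟩
    have := hsupp w'' hw'' (Eq.trans hx hwy) s hs hws''
    rw [← this] at hjs
    simp [hj0] at hjs
  · rintro s ⟨hs, hys⟩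
    obtain ⟨w, hw, hws, hwy⟩ := (mem_convexHull_iff_labelMap s).1 hys
    exact ⟨w, ⟨⟨hw, s, ⟨(K.isRelLowerSet_faces hs.1).1, s, hs.1, hs.2.1, hs.2.2, subset_rfl⟩, hws⟩,
      hwy⟩, hsupp w hw hwy s hs hws⟩

end Degree

section Count

variable {V : Type*} [Fintype V] {m : ℕ} {E : Type*} [NormedAddCommGroup E] [NormedSpace ℝ E]
  [FiniteDimensional ℝ E]

open Classical in
/-- The conclusion for a convex body with marked points, each of which lies outside the convex hull
of the others. -/
theorem le_ncard_fullyLabelled {d : ℕ} (hd : Module.finrank ℝ E = d) {P : Set E} (hP : Convex ℝ P)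
    (hPc : IsClosed P) (hPi : (interior P).Nonempty) (v : Fin m → E)
    (hvP : ∀ i, v i ∈ P) (hvert : ∀ i, v i ∉ convexHull ℝ (v '' {i}ᶜ))
    (K : PreAbstractSimplicialComplex V) (L : V → Fin m)
    (hBd : labelMap v L '' space (Bd K d) ⊆ frontier P)
    (hdeg : modTwoDegree (Bd K d) (d - 1) (labelMap v L) (frontier P) = 1) :
    m ≤ d + (fullyLabelled K d L).ncard := by
  obtain ⟨y, hy, hodd⟩ : ∃ y, IsRegularValue (Bd K d) (d - 1) (labelMap v L) (frontier P) y ∧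
      Odd {w | w ∈ space (Bd K d) ∧ labelMap v L w = y}.ncard := by
    by_contra h
    simp [modTwoDegree, h] at hdeg
  rw [hy.ncard_preimage] at hodd
  set g := v ∘ L with hg
  have hgL : ∀ s : Finset V, InjOn g (s : Set V) → InjOn L (s : Set V) := fun s h =>
    InjOn.of_comp h
  have hfr : ∀ s ∈ bdFacets K d, convexHull ℝ (g '' (s : Set V)) ⊆ frontier P := fun s hs =>
    (convexHull_subset_image_space_Bd hs).trans hBd
  have hcard : ∀ s ∈ bdFacets K d, s.card = Module.finrank ℝ E := fun s hs => hd ▸ hs.2.1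
  have hreg : ∀ s ∈ bdFacets K d, ∀ t ⊆ s, t.card < s.card →
      y ∉ convexHull ℝ (g '' (t : Set V)) := fun s hs t => hy.notMem_convexHull hs
  set S : Finset (Finset V) := Finset.univ.filter fun s =>
    s ∈ bdFacets K d ∧ y ∈ convexHull ℝ (g '' (s : Set V)) with hSdef
  have hS : ∀ s, s ∈ S ↔ s ∈ bdFacets K d ∧ y ∈ convexHull ℝ (g '' (s : Set V)) := by simp [hSdef]
  have hSodd : Odd S.card := by
    rwa [← Set.ncard_coe_finset, show (S : Set (Finset V)) = _ from Set.ext hS]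
  obtain ⟨s₀, hs₀⟩ : S.Nonempty := Finset.card_pos.1 hSodd.pos
  have hdpos : 0 < d := by
    have h := ((hS s₀).1 hs₀).1
    exact h.2.1 ▸ (K.isRelLowerSet_faces h.1).1.card_pos
  obtain ⟨y', hy'fr, hy'gen, hy'iff⟩ := exists_generic_mem_frontier hP hPc hPi g (bdFacets K d)
    hcard hfr hreg ⟨s₀, (hS s₀).1 hs₀⟩
  set A : Finset (Finset V) := Finset.univ.filter fun r => r ∈ K.faces ∧ r.card = d + 1 with hAdef
  have hA : ∀ r, r ∈ A ↔ r ∈ K.faces ∧ r.card = d + 1 := by simp [hAdef]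
  have hAncard : ∀ s : Finset V, {r : Finset V | r ∈ K.faces ∧ r.card = d + 1 ∧ s ⊆ r}.ncard =
      (A.filter fun r => s ⊆ r).card := by
    intro s
    rw [← Set.ncard_coe_finset]
    congr 1
    ext r
    simp [hA, and_assoc]
  have hSfacet : ∀ s ∈ S, s.card = d ∧ InjOn L (s : Set V) ∧ ∃ r ∈ A, s ⊆ r := by
    intro s hs
    obtain ⟨hsB, hys⟩ := (hS s).1 hs
    refine ⟨hsB.2.1, hgL s (injOn_of_mem_convexHull (hreg s hsB) hys), ?_⟩
    have := hsB.2.2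
    rw [hAncard] at this
    obtain ⟨r, hr⟩ := Finset.card_pos.1 this.pos
    exact ⟨r, by simpa using hr⟩
  obtain ⟨C, hCA, hcl, hconn, hCodd⟩ := exists_odd_component L d A S hSfacet hSodd
  have hCcard : ∀ r ∈ C, r.card = d + 1 := fun r hr => ((hA r).1 (hCA hr)).2
  -- the cofaces in `C` of a facet that touches `C` are all its cofaces
  have hcoface : ∀ s : Finset V, s.card = d → InjOn L (s : Set V) → (∃ r ∈ C, s ⊆ r) →
      (C.filter fun r => s ⊆ r) = A.filter fun r => s ⊆ r := by
    rintro s hsc hsL ⟨r, hr, hsr⟩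
    ext r'
    simp only [Finset.mem_filter]
    exact ⟨fun h => ⟨hCA h.1, h.2⟩, fun h => ⟨hcl r hr r' h.1 ⟨s, hsc, hsL, hsr, h.2⟩, h.2⟩⟩
  have hbd : ∀ s : Finset V, s.card = d → InjOn L (s : Set V) →
      Odd (C.filter fun r => s ⊆ r).card → s ∈ bdFacets K d ∧ ∃ r ∈ C, s ⊆ r := by
    intro s hsc hsL hso
    obtain ⟨r, hr⟩ := Finset.card_pos.1 hso.pos
    have hr : r ∈ C ∧ s ⊆ r := by simpa using hr
    refine ⟨⟨(K.isRelLowerSet_faces ((hA r).1 (hCA hr.1)).1).2 hr.2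
      (Finset.card_pos.1 (by omega)), hsc, ?_⟩, r, hr⟩
    rwa [hAncard, ← hcoface s hsc hsL ⟨r, hr⟩]
  -- every label occurs in `C`, as otherwise `C` misses the interior points near some vertex
  have hlabel : ∀ i, i ∈ (C.biUnion id).image L := by
    intro i
    by_contra hi
    have hcl' : IsClosed (convexHull ℝ (v '' {i}ᶜ)) :=
      ((Set.toFinite (v '' {i}ᶜ)).isCompact_convexHull (𝕜 := ℝ)).isClosed
    have hvi : v i ∈ closure (interior P) := by
      rw [hP.closure_interior_eq_closure_of_nonempty_interior hPi]
      exact subset_closure (hvP i)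
    obtain ⟨a, ha, haP⟩ := mem_closure_iff.1 hvi _ hcl'.isOpen_compl (hvert i)
    have heven := even_card_boundary_of_disjoint hP (hcl'.isOpen_compl.inter isOpen_interior)
      ⟨a, ha, haP⟩ inter_subset_right g C (fun r hr => hd ▸ hCcard r hr) (by
        intro r hr p hp hpr
        refine hp.1 (convexHull_mono ?_ hpr)
        rintro _ ⟨u, hu, rfl⟩
        refine ⟨L u, fun h => hi ?_, rfl⟩
        exact Finset.mem_image.2 ⟨u, Finset.mem_biUnion.2 ⟨r, hr, hu⟩, h⟩)
      hy'fr hy'gen (fun s hsc hsg hso => hfr s (hbd s (hsc.trans hd) (hgL s hsg) hso).1)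
    rw [← Nat.not_even_iff_odd] at hCodd
    refine hCodd ?_
    convert heven using 2
    ext s
    simp only [Finset.mem_filter, Finset.mem_powersetCard, Finset.subset_univ, true_and, hS]
    constructor
    · rintro ⟨⟨hsB, hys⟩, hsC⟩
      refine ⟨hcard s hsB, ?_, (hy'iff s hsB).2 hys⟩
      have h := hSfacet s ((hS s).2 ⟨hsB, hys⟩)
      rw [hcoface s h.1 h.2.1 hsC, ← hAncard]
      exact hsB.2.2
    · rintro ⟨hsc, hso, hys⟩
      have hsL := hgL s (injOn_of_mem_convexHull (fun t _ ht => hy'gen t (hsc ▸ ht)) hys)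
      obtain ⟨hsB, hsC⟩ := hbd s (hsc.trans hd) hsL hso
      exact ⟨⟨hsB, (hy'iff s hsB).1 hys⟩, hsC⟩
  have hcount : m ≤ d + (C.filter fun r : Finset V => InjOn L (r : Set V)).card := by
    have hm : ((C.biUnion id).image L).card = m := by
      rw [Finset.eq_univ_of_forall hlabel, Finset.card_univ, Fintype.card_fin]
    calc m = ((C.biUnion id).image L).card := hm.symm
      _ ≤ _ := by convert card_labels_le_of_connected L d C hCcard hconn
  refine hcount.trans (Nat.add_le_add_left ?_ d)
  rw [← Set.ncard_coe_finset]
  refine Set.ncard_le_ncard (fun r hr => ?_) (Set.toFinite _)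
  have hr : r ∈ C ∧ InjOn L (r : Set V) := by simpa using hr
  exact ⟨((hA r).1 (hCA hr.1)).1, hCcard r hr.1, hr.2⟩

end Count

end LabelledComplex

theorem theorem3p6 (d m : ℕ)
    -- a full-dimensional convex polytope with exactly `m` vertices `v 0, …, v (m - 1)`
    (P : Set (EuclideanSpace ℝ (Fin d)))
    (hP : LabelledComplex.IsConvexPolytope P) (hPint : (interior P).Nonempty)
    (v : Fin m → EuclideanSpace ℝ (Fin d)) (hv : Function.Injective v)
    (hvert : Set.range v = P.extremePoints ℝ)
    -- a triangulation `T`, with vertex set `V`, of a finite `d`-dimensional simplicial complex `X`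
    {V W : Type*} [Fintype V] [Fintype W]
    (T : AbstractSimplicialComplex V) (X : AbstractSimplicialComplex W)
    (hX : LabelledComplex.HasDim X.toPreAbstractSimplicialComplex d)
    (hT : LabelledComplex.IsTriangulationOf T.toPreAbstractSimplicialComplex
      X.toPreAbstractSimplicialComplex)
    (L : V → Fin m)
    (hBd : LabelledComplex.labelMap v L ''
      LabelledComplex.space (LabelledComplex.Bd T.toPreAbstractSimplicialComplex d) ⊆ frontier P)
    (hdeg : LabelledComplex.modTwoDegree (LabelledComplex.Bd T.toPreAbstractSimplicialComplex d)
      (d - 1) (LabelledComplex.labelMap v L) (frontier P) = 1) :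
    (m : ℤ) - (d : ℤ) ≤
      ((LabelledComplex.fullyLabelled T.toPreAbstractSimplicialComplex d L).ncard : ℤ) := by
  obtain ⟨s, hs, rfl⟩ := hP
  have hext : ∀ i, v i ∈ (convexHull ℝ s).extremePoints ℝ := fun i => hvert ▸ mem_range_self i
  have key := LabelledComplex.le_ncard_fullyLabelled (finrank_euclideanSpace_fin (𝕜 := ℝ) (n := d))
    (convex_convexHull ℝ s) (hs.isCompact_convexHull (𝕜 := ℝ)).isClosed hPint v
    (fun i => (hext i).1) (fun i hi => ?_) T.toPreAbstractSimplicialComplex L hBd hdeg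
  · omega
  · -- the body without the extreme point `v i` is convex and contains the other vertices
    have hconv := ((convex_convexHull ℝ s).mem_extremePoints_iff_convex_sdiff.1 (hext i)).2
    refine (convexHull_min ?_ hconv hi).2 rfl
    rintro _ ⟨j, hj, rfl⟩
    exact ⟨(hext j).1, fun h => hj (hv h)⟩
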